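/- Let $\mathsf X$ be a denumerable set of variables. The terms of $\Lambda_\oplus$ are given by $M,N ::= x \mid \lambda x.M \mid MN \mid M\oplus N$ with $x\in\mathsf X$, and are taken up to renaming of bound variables. For a finite $\overline x\subseteq\mathsf X$, $\Lambda_\oplus(\overline x)$ is the set of terms whose free variables lie in $\overline x$. Terms in $\Lambda_\oplus(\emptyset)$ are called closed, and the set of values $\mathsf V\Lambda_\oplus$ consists of the closed abstractions. *Semantics.* The judgments $M\Downarrow\mathscr D$, with $M$ closed and $\mathscr D$ a finitely supported subprobability distribution on $\mathsf V\Lambda_\oplus$, are derived inductively as follows: $M\Downarrow\emptyset$ (the zero distribution) for every closed $M$; $V\Downarrow\{V\}$ (the point mass at $V$) for every value $V$; if $M\Downarrow\mathscr D$ and $P\{N/x\}\Downarrow\mathscr E_{P,N}$ for every $\lambda x.P$ in the support of $\mathscr D$, then $MN\Downarrow\sum_{\lambda x.P\in\mathrm{supp}(\mathscr D)}\mathscr D(\lambda x.P)\cdot\mathscr E_{P,N}$; if $M\Downarrow\mathscr D$ and $N\Downarrow\mathscr E$, then $M\oplus N\Downarrow\frac12\mathscr D+\frac12\mathscr E$.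 The call-by-name semantics of $M$ is the pointwise supremum $[\![M]\!]=\sup_{M\Downarrow\mathscr D}\mathscr D$. *Markov chain.* Consider the labelled Markov chain with set of states the disjoint union $\mathcal S=\Lambda_\oplus(\emptyset)\uplus\mathsf V\Lambda_\oplus$ (the elements of the second component, written $\nu x.N$, are called distinguished values; the two components are the two sorts), with labels $\Lambda_\oplus(\emptyset)\uplus\{\tau\}$, and with transition probabilities $\mathcal P(M,\tau,\nu x.N)=[\![M]\!](\lambda x.N)$ and $\mathcal P(\nu x.N,M,N\{M/x\})=1$ for every closed term $M$ and every distinguished value $\nu x.N$, and $\mathcal P=0$ in all other cases. Write $\mathcal P(s,\ell,X)=\sum_{t\in X}\mathcal P(s,\ell,t)$ for $X\subseteq\mathcal S$. A *probabilistic applicative simulation* is a preorder $\mathcal R$ on $\mathcal S$ that only relates states of the same sort and is such that $s\,\mathcal R\,t$ implies $\mathcal P(s,\ell,X)\le\mathcal P(t,\ell,\mathcal R(X))$ for every label $\ell$ and every $X\subseteq\mathcal S$, where $\mathcal R(X)=\{y\mid\exists x\in X,\ x\,\mathcal R\,y\}$. A *probabilistic applicative bisimulation* is an equivalence relation $\mathcal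 R$ on $\mathcal S$ that only relates states of the same sort and is such that $s\,\mathcal R\,t$ implies $\mathcal P(s,\ell,E)=\mathcal P(t,\ell,E)$ for every label $\ell$ and every equivalence class $E$ of $\mathcal R$. *Probabilistic applicative similarity* $\lesssim$ (respectively *bisimilarity* $\sim$) is the union of all probabilistic applicative simulations (respectively bisimulations), restricted to closed terms. Both are extended to open terms by closing substitutions: for $M,N\in\Lambda_\oplus(\overline x)$, $\overline x\vdash M\lesssim N$ holds if and only if $M\sigma\lesssim N\sigma$ for every substitution $\sigma$ of closed terms for the variables in $\overline x$, and similarly for $\sim$. *Congruences.* A $\Lambda_\oplus$-relation is a set $\mathcal R$ of triples $(\overline x,M,N)$ with $\overline x\subseteq\mathsf X$ finite and $M,N\in\Lambda_\oplus(\overline x)$, written $\overline x\vdash M\,\mathcal R\,N$. It is *compatible* if, for every finite $\overline x\subseteq\mathsf X$: 1. $\overline x\vdash x\,\mathcal R\,x$ for all $x\in\overline x$; 2. for all $x\in\mathsf X\setminus\overline x$ and $M,N\in\Lambda_\oplus(\overline x\cup\{x\})$, $\overline x\cup\{x\}\vdash M\,\mathcal R\,N$ implies $\overline x\vdash\lambda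 x.M\,\mathcal R\,\lambda x.N$; 3. for all $M,N,L,P\in\Lambda_\oplus(\overline x)$, $\overline x\vdash M\,\mathcal R\,N$ and $\overline x\vdash L\,\mathcal R\,P$ imply $\overline x\vdash ML\,\mathcal R\,NP$; 4. for all $M,N,L,P\in\Lambda_\oplus(\overline x)$, $\overline x\vdash M\,\mathcal R\,N$ and $\overline x\vdash L\,\mathcal R\,P$ imply $\overline x\vdash M\oplus L\,\mathcal R\,N\oplus P$. A *precongruence* (respectively *congruence*) is a compatible $\Lambda_\oplus$-relation that is, for every $\overline x$, a preorder (respectively an equivalence relation) on $\Lambda_\oplus(\overline x)$. **Theorem.** Probabilistic applicative similarity $\lesssim$ is a precongruence, and probabilistic applicative bisimilarity $\sim$ is a congruence. -/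

import Mathlib

open scoped NNReal ENNReal

noncomputable section

namespace ProbLambda

/-! ## Terms -/

/-- The denumerable set of variables. -/
abbrev Var : Type := ℕ

/-- Terms of the probabilistic lambda-calculus, up to renaming of bound variables: free variables
are elements of `A`, and bound variables are de Bruijn indices. A term of `Tm A n` lies below `n`
pending binders, `bvar 0` being bound by the innermost one. So `Tm A 0` is the set of
alpha-equivalence classes of terms whose free variables are among the elements of `A`. -/
inductive Tm (A : Type) : ℕ → Type
  | fvar {n : ℕ} (a : A) : Tm A n
  | bvar {n : ℕ} (i : Fin n) : Tm A n
  | lam {n : ℕ} (M : Tm A (n + 1)) : Tm A n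
  | app {n : ℕ} (M N : Tm A n) : Tm A n
  | choice {n : ℕ} (M N : Tm A n) : Tm A n

namespace Tm

variable {A B : Type}

/-- Renaming of bound variables. -/
def rename : {n m : ℕ} → (Fin n → Fin m) → Tm A n → Tm A m
  | _, _, _, fvar a => fvar a
  | _, _, ρ, bvar i => bvar (ρ i)
  | _, _, ρ, lam M => lam (rename (Fin.cases 0 (fun i => (ρ i).succ)) M)
  | _, _, ρ, app M N => app (rename ρ M) (rename ρ N)
  | _, _, ρ, choice M N => choice (rename ρ M) (rename ρ N)

/-- Moving a term below one more binder. -/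
def shift {n : ℕ} (M : Tm A n) : Tm A (n + 1) := rename Fin.succ M

/-- Simultaneous capture-avoiding substitution: `σ` for the free variables, `θ` for the indices. -/
def subst : {n m : ℕ} → (A → Tm B m) → (Fin n → Tm B m) → Tm A n → Tm B m
  | _, _, σ, _, fvar a => σ a
  | _, _, _, θ, bvar i => θ i
  | _, _, σ, θ, lam M =>
      lam (subst (fun a => shift (σ a)) (Fin.cases (bvar 0) (fun i => shift (θ i))) M)
  | _, _, σ, θ, app M N => app (subst σ θ M) (subst σ θ N)
  | _, _, σ, θ, choice M N => choice (subst σ θ M) (subst σ θ N)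

/-- If `P` is the body of the abstraction `λx.P`, this is `P{N/x}`. -/
def inst (P : Tm A 1) (N : Tm A 0) : Tm A 0 := subst fvar (fun _ => N) P

/-- The term is an abstraction. -/
def IsLam : {n : ℕ} → Tm A n → Prop
  | _, lam _ => True
  | _, _ => False

/-- A numerical code, used only to see that there are countably many terms. -/
def code (e : A → ℕ) : {n : ℕ} → Tm A n → ℕ
  | _, fvar a => Nat.pair 0 (e a)
  | _, bvar i => Nat.pair 1 i
  | _, lam M => Nat.pair 2 (code e M)
  | _, app M N => Nat.pair 3 (Nat.pair (code e M) (code e N))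
  | _, choice M N => Nat.pair 4 (Nat.pair (code e M) (code e N))

theorem code_injective {e : A → ℕ} (he : Function.Injective e) :
    ∀ {n : ℕ} (M N : Tm A n), code e M = code e N → M = N := by
  intro n M
  induction M with
  | fvar a => intro N h; cases N <;> simp_all [code, he.eq_iff]
  | bvar i => intro N h; cases N <;> simp_all [code, Fin.val_inj]
  | lam M ih =>
      intro N h
      cases N <;> simp only [code, Nat.pair_eq_pair] at h <;> try omega
      rw [ih _ h.2]
  | app M M' ih ih' =>
      intro N h
      cases N <;> simp only [code, Nat.pair_eq_pair] at h <;> try omega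
      rw [ih _ h.2.1, ih' _ h.2.2]
  | choice M M' ih ih' =>
      intro N h
      cases N <;> simp only [code, Nat.pair_eq_pair] at h <;> try omega
      rw [ih _ h.2.1, ih' _ h.2.2]

instance [Countable A] (n : ℕ) : Countable (Tm A n) := by
  obtain ⟨e, he⟩ := exists_injective_nat A
  exact Function.Injective.countable (f := code e) fun M N h => code_injective he M N h

end Tm

/-- The set of terms whose free variables are among those of the finite set `xs`. -/
abbrev Term (xs : Finset Var) : Type := Tm {x : Var // x ∈ xs} 0

/-- Closed terms. -/
abbrev Closed : Type := Term ∅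

/-- The abstraction `λx.M`. -/
def abs {xs : Finset Var} (x : Var) (M : Term (insert x xs)) : Term xs :=
  Tm.lam (Tm.subst
    (fun y => if h : y.1 = x then Tm.bvar 0
      else Tm.fvar ⟨y.1, Finset.mem_of_mem_insert_of_ne y.2 h⟩)
    Fin.elim0 M)

/-- The result of replacing every free variable `x` of `M` by the closed term `σ x`. -/
def close {xs : Finset Var} (σ : {x : Var // x ∈ xs} → Closed) (M : Term xs) : Closed :=
  Tm.subst σ Fin.elim0 M

/-- Values: closed abstractions. -/
def Value : Type := {M : Closed // M.IsLam}

instance : Countable Value := Subtype.countable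

/-- The value `λx.P`, given by its body `P`. -/
def Value.mk (P : Tm {x : Var // x ∈ (∅ : Finset Var)} 1) : Value := ⟨Tm.lam P, trivial⟩

/-- The body `P` of the value `λx.P`. -/
def Value.body : Value → Tm {x : Var // x ∈ (∅ : Finset Var)} 1
  | ⟨Tm.lam P, _⟩ => P

/-! ## Call-by-name semantics -/

/-- Big-step approximation semantics: `BigStep M D` means that `D`, a value distribution of finite
support, is derivable as a lower approximation to the semantics of `M`. -/
inductive BigStep : Closed → (Value →₀ ℝ≥0) → Prop
  | bt (M : Closed) : BigStep M 0
  | bv (P : Tm {x : Var // x ∈ (∅ : Finset Var)} 1) :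
      BigStep (Tm.lam P) (Finsupp.single (Value.mk P) 1)
  | ba {M N : Closed} {D : Value →₀ ℝ≥0} (E : Value → (Value →₀ ℝ≥0))
      (hM : BigStep M D) (hE : ∀ V ∈ D.support, BigStep (V.body.inst N) (E V)) :
      BigStep (Tm.app M N) (∑ V ∈ D.support, D V • E V)
  | bs {M N : Closed} {D E : Value →₀ ℝ≥0} (hM : BigStep M D) (hN : BigStep N E) :
      BigStep (Tm.choice M N) ((1 / 2 : ℝ≥0) • D + (1 / 2 : ℝ≥0) • E)

theorem sum_superset {D : Value →₀ ℝ≥0} {s : Finset Value} (h : D.support ⊆ s)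
    (E : Value → (Value →₀ ℝ≥0)) :
    ∑ V ∈ D.support, D V • E V = ∑ V ∈ s, D V • E V := by
  refine Finset.sum_subset h fun V _ hV => ?_
  rw [Finsupp.notMem_support_iff.1 hV, zero_smul]

/-- The lower approximations to the semantics of a term form a directed set. -/
theorem BigStep.directed {M : Closed} {D : Value →₀ ℝ≥0} (h : BigStep M D) :
    ∀ {D' : Value →₀ ℝ≥0}, BigStep M D' → ∃ F, BigStep M F ∧ D ≤ F ∧ D' ≤ F := by
  classical
  induction h with
  | bt M => exact fun {D'} h' => ⟨D', h', zero_le, le_rfl⟩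
  | bv P =>
      intro D' h'
      cases h' with
      | bt => exact ⟨_, .bv P, le_rfl, zero_le⟩
      | bv => exact ⟨_, .bv P, le_rfl, le_rfl⟩
  | @bs M N D E hM hN ihM ihN =>
      intro D' h'
      cases h' with
      | bt => exact ⟨_, .bs hM hN, le_rfl, zero_le⟩
      | bs hM' hN' =>
          obtain ⟨F, hF, h1, h2⟩ := ihM hM'
          obtain ⟨G, hG, h3, h4⟩ := ihN hN'
          refine ⟨_, .bs hF hG, ?_, ?_⟩ <;> intro V <;>
            simp only [Finsupp.add_apply, Finsupp.smul_apply, smul_eq_mul] <;> gcongr <;> apply_assumption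
  | @ba M N D E hM hE ihM ihE =>
      intro D' h'
      cases h' with
      | bt => exact ⟨_, .ba E hM hE, le_rfl, zero_le⟩
      | @ba _ _ D' E' hM' hE' =>
          obtain ⟨F, hF, h1, h2⟩ := ihM hM'
          have key : ∀ V, ∃ G, BigStep (V.body.inst N) G ∧
              (V ∈ D.support → E V ≤ G) ∧ (V ∈ D'.support → E' V ≤ G) := by
            intro V
            by_cases hV : V ∈ D.support <;> by_cases hV' : V ∈ D'.support
            · obtain ⟨G, hG, h3, h4⟩ := ihE V hV (hE' V hV')
              exact ⟨G, hG, fun _ => h3, fun _ => h4⟩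
            · exact ⟨E V, hE V hV, fun _ => le_rfl, fun h => absurd h hV'⟩
            · exact ⟨E' V, hE' V hV', fun h => absurd h hV, fun _ => le_rfl⟩
            · exact ⟨0, .bt _, fun h => absurd h hV, fun h => absurd h hV'⟩
          choose G hG h3 h4 using key
          have aux : ∀ (C : Value →₀ ℝ≥0) (K : Value → (Value →₀ ℝ≥0)), C ≤ F →
              (∀ V ∈ C.support, K V ≤ G V) →
              ∑ V ∈ C.support, C V • K V ≤ ∑ V ∈ F.support, F V • G V := by
            intro C K hC hK W
            rw [sum_superset (s := C.support ∪ F.support) Finset.subset_union_left K,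
              sum_superset (s := C.support ∪ F.support) Finset.subset_union_right G]
            simp only [Finsupp.finsetSum_apply, Finsupp.smul_apply, smul_eq_mul]
            refine Finset.sum_le_sum fun V _ => ?_
            by_cases hV : V ∈ C.support
            · exact mul_le_mul' (hC V) (hK V hV W)
            · rw [Finsupp.notMem_support_iff.1 hV, zero_mul]
              exact zero_le
          exact ⟨_, .ba G hF fun V _ => hG V, aux D E h1 h3, aux D' E' h2 h4⟩

/-- A lower approximation has total mass at most one. -/
theorem BigStep.sum_le_one {M : Closed} {D : Value →₀ ℝ≥0} (h : BigStep M D) :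
    ∀ s : Finset Value, ∑ V ∈ s, D V ≤ 1 := by
  classical
  induction h with
  | bt M => intro s; simp
  | bv P =>
      intro s
      simp only [Finsupp.single_apply, Finset.sum_ite_eq]
      split_ifs <;> simp
  | @bs M N D E hM hN ihM ihN =>
      intro s
      simp only [Finsupp.add_apply, Finsupp.smul_apply, smul_eq_mul, Finset.sum_add_distrib,
        ← Finset.mul_sum]
      calc (1 / 2 : ℝ≥0) * ∑ V ∈ s, D V + 1 / 2 * ∑ V ∈ s, E V
          ≤ 1 / 2 * 1 + 1 / 2 * 1 := by gcongr <;> simp_all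
        _ = 1 := by rw [mul_one]; exact add_halves 1
  | @ba M N D E hM hE ihM ihE =>
      intro s
      simp only [Finsupp.finsetSum_apply, Finsupp.smul_apply, smul_eq_mul]
      rw [Finset.sum_comm]
      simp only [← Finset.mul_sum]
      calc ∑ V ∈ D.support, D V * ∑ W ∈ s, E V W
          ≤ ∑ V ∈ D.support, D V * 1 :=
            Finset.sum_le_sum fun V hV => by gcongr; exact ihE V hV s
        _ ≤ 1 := by simpa using ihM D.support

/-- The semantics of a closed term: the least upper bound of its lower approximations. -/
def sem (M : Closed) (V : Value) : ℝ≥0∞ :=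
  ⨆ D : {D : Value →₀ ℝ≥0 // BigStep M D}, ((D.1 V : ℝ≥0) : ℝ≥0∞)

/-- The semantics of a closed term is a (partial) value distribution. -/
theorem sem_tsum_le_one (M : Closed) : ∑' V : Value, sem M V ≤ 1 := by
  rw [ENNReal.tsum_eq_iSup_sum]
  refine iSup_le fun s => ?_
  unfold sem
  rw [ENNReal.finsetSum_iSup]
  · refine iSup_le fun D => ?_
    exact_mod_cast D.2.sum_le_one s
  · intro D D'
    obtain ⟨F, hF, h1, h2⟩ := D.2.directed D'.2
    exact ⟨⟨F, hF⟩, fun V => ⟨by exact_mod_cast h1 V, by exact_mod_cast h2 V⟩⟩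

/-! ## Multisorted labelled Markov chains, probabilistic simulation and bisimulation -/

/-- A multisorted labelled Markov chain: a countable set `S` of states, each of which belongs to one
of a family (indexed by `I`) of disjoint sorts, a set `L` of labels, and a transition probability
matrix. -/
structure LMC (S L I : Type) [Countable S] where
  prob : S → L → S → ℝ≥0∞
  prob_le_one : ∀ s l, ∑' t : S, prob s l t ≤ 1
  sort : S → I

namespace LMC

variable {S L I : Type} [Countable S]

/-- The probability to move from `s` into the set `X` under the label `l`. -/
def probSet (C : LMC S L I) (s : S) (l : L) (X : Set S) : ℝ≥0∞ := ∑' t : X, C.prob s l t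

/-- Probabilistic simulations on a multisorted labelled Markov chain. -/
structure IsSimulation (C : LMC S L I) (R : S → S → Prop) : Prop where
  refl : ∀ s, R s s
  trans : ∀ s t u, R s t → R t u → R s u
  sort_eq : ∀ s t, R s t → C.sort s = C.sort t
  prob_le : ∀ s t, R s t → ∀ (l : L) (X : Set S),
    C.probSet s l X ≤ C.probSet t l {y | ∃ x ∈ X, R x y}

/-- Probabilistic bisimulations on a multisorted labelled Markov chain; `{v | R u v}` is the
equivalence class of `u`. -/
structure IsBisimulation (C : LMC S L I) (R : S → S → Prop) : Prop where
  equivalence : Equivalence R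
  sort_eq : ∀ s t, R s t → C.sort s = C.sort t
  prob_eq : ∀ s t, R s t → ∀ (l : L) (u : S),
    C.probSet s l {v | R u v} = C.probSet t l {v | R u v}

/-- Probabilistic similarity: the union of all probabilistic simulations. -/
def Similar (C : LMC S L I) (s t : S) : Prop := ∃ R, C.IsSimulation R ∧ R s t

/-- Probabilistic bisimilarity: the union of all probabilistic bisimulations. -/
def Bisimilar (C : LMC S L I) (s t : S) : Prop := ∃ R, C.IsBisimulation R ∧ R s t

end LMC

/-! ## Probabilistic applicative similarity and bisimilarity -/

/-- States: closed terms (left) and distinguished values (right). -/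
abbrev State : Type := Closed ⊕ Value

/-- Labels: closed terms (left) and the evaluation label `τ` (right). -/
abbrev Label : Type := Closed ⊕ Unit

open Classical in
/-- The transition probability matrix: a term evaluates to distinguished values according to its
semantics, a distinguished value `λx.P` goes to `P{N/x}` with probability one when it receives
the closed term `N`, and there are no other transitions. -/
def transProb : State → Label → State → ℝ≥0∞
  | .inl M, .inr _, .inr V => sem M V
  | .inr V, .inl N, .inl M => if M = V.body.inst N then 1 else 0
  | _, _, _ => 0

theorem transProb_le_one (s : State) (l : Label) : ∑' t : State, transProb s l t ≤ 1 := by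
  rw [Summable.tsum_sum ENNReal.summable ENNReal.summable]
  rcases s with M | V <;> rcases l with N | _ <;> simp [transProb, sem_tsum_le_one]

/-- The calculus as a multisorted labelled Markov chain. -/
def chain : LMC State Label Bool where
  prob := transProb
  prob_le_one := transProb_le_one
  sort := Sum.isLeft

/-- Probabilistic applicative similarity, on closed terms. -/
def PAS (M N : Closed) : Prop := chain.Similar (.inl M) (.inl N)

/-- Probabilistic applicative bisimilarity, on closed terms. -/
def PAB (M N : Closed) : Prop := chain.Bisimilar (.inl M) (.inl N)

/-! ## Relations on open terms, congruences -/

/-- Relations on open terms: sets of triples `(xs, M, N)` where the free variables of `M` and `N`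
are among the finite set `xs`. -/
def TermRel : Type := ∀ xs : Finset Var, Term xs → Term xs → Prop

/-- The open extension of a relation on closed terms: all closing substitutions are considered. -/
def openExt (R : Closed → Closed → Prop) : TermRel :=
  fun xs M N => ∀ σ : {x : Var // x ∈ xs} → Closed, R (close σ M) (close σ N)

namespace TermRel

structure Compatible (R : TermRel) : Prop where
  com1 : ∀ (xs : Finset Var) (x : Var) (hx : x ∈ xs), R xs (Tm.fvar ⟨x, hx⟩) (Tm.fvar ⟨x, hx⟩)
  com2 : ∀ (xs : Finset Var) (x : Var), x ∉ xs → ∀ M N : Term (insert x xs),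
    R (insert x xs) M N → R xs (abs x M) (abs x N)
  com3 : ∀ (xs : Finset Var) (M N L P : Term xs),
    R xs M N → R xs L P → R xs (Tm.app M L) (Tm.app N P)
  com4 : ∀ (xs : Finset Var) (M N L P : Term xs),
    R xs M N → R xs L P → R xs (Tm.choice M L) (Tm.choice N P)

/-- A precongruence is a compatible preorder. -/
structure Precongruence (R : TermRel) : Prop where
  compatible : R.Compatible
  refl : ∀ (xs : Finset Var) (M : Term xs), R xs M M
  trans : ∀ (xs : Finset Var) (M N L : Term xs), R xs M N → R xs N L → R xs M L

/-- A congruence is a compatible equivalence relation. -/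
structure Congruence (R : TermRel) : Prop where
  compatible : R.Compatible
  equivalence : ∀ xs : Finset Var, Equivalence (R xs)

end TermRel

end ProbLambda

end

open scoped NNReal ENNReal

noncomputable section

namespace ProbLambda

/-! ## Substitution -/

namespace Tm

variable {A B C : Type}

/-! A context is a term whose free variables, its holes, are named by pairs of similar closed terms.
Relate `M` to `N` (`CtxLe`) when `M` is a context filled with the smaller terms and the same context
filled with the larger terms is similar to `N`. Everything reduces to showing that this relation is
contained in similarity, since it is visibly closed under application and choice.

The core is `BigStep.mass_le_upper`, an induction on derivations. When the context is a single hole,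
similarity itself gives the bound. In an application, the function part evaluates to bodies that are
again contexts, and call-by-name substitutes the argument unevaluated, so the continuation is a
context too. The resulting weighted sums are compared by integrating over superlevel sets
(`tsum_mul_le_of_mass_le`); no coupling of the two distributions is needed. Abstractions are handled
directly by `pas_lam`, as their semantics is a point mass.

Bisimilarity reduces to similarity: it is the intersection of similarity with its converse
(`LMC.bisimilar_iff`), so congruence follows from the compatibility of similarity used in both
directions. -/

theorem subst_rename {n m k : ℕ} (ρ : Fin n → Fin m) (σ : A → Tm B k) (θ : Fin m → Tm B k)
    (M : Tm A n) : subst σ θ (rename ρ M) = subst σ (fun i => θ (ρ i)) M := by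
  induction M generalizing m k with
  | fvar a => simp [rename, subst]
  | bvar i => simp [rename, subst]
  | lam M ih =>
      simp only [rename, subst, ih]
      congr 2
      funext i
      cases i using Fin.cases <;> simp
  | app M N ihM ihN => simp [rename, subst, ihM, ihN]
  | choice M N ihM ihN => simp [rename, subst, ihM, ihN]

theorem rename_rename {n m k : ℕ} (ρ : Fin n → Fin m) (ρ' : Fin m → Fin k) (M : Tm A n) :
    rename ρ' (rename ρ M) = rename (fun i => ρ' (ρ i)) M := by
  induction M generalizing m k with
  | fvar a => simp [rename]
  | bvar i => simp [rename]
  | lam M ih =>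
      simp only [rename, ih]
      congr 2
      funext i
      cases i using Fin.cases <;> simp
  | app M N ihM ihN => simp [rename, ihM, ihN]
  | choice M N ihM ihN => simp [rename, ihM, ihN]

theorem rename_shift {n m : ℕ} (ρ : Fin n → Fin m) (M : Tm A n) :
    rename (Fin.cases 0 (fun i => (ρ i).succ)) (shift M) = shift (rename ρ M) := by
  simp [shift, rename_rename]

theorem rename_subst {n m k : ℕ} (σ : A → Tm B m) (θ : Fin n → Tm B m) (ρ : Fin m → Fin k)
    (M : Tm A n) :
    rename ρ (subst σ θ M) = subst (fun a => rename ρ (σ a)) (fun i => rename ρ (θ i)) M := by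
  induction M generalizing m k with
  | fvar a => simp [subst]
  | bvar i => simp [subst]
  | lam M ih =>
      simp only [rename, subst, ih, rename_shift]
      congr 2
      funext i
      cases i using Fin.cases <;> simp [rename, rename_shift]
  | app M N ihM ihN => simp [rename, subst, ihM, ihN]
  | choice M N ihM ihN => simp [rename, subst, ihM, ihN]

theorem subst_shift {n m : ℕ} (σ : A → Tm B m) (θ : Fin n → Tm B m) (M : Tm A n) :
    subst (fun a => shift (σ a)) (Fin.cases (bvar 0) (fun i => shift (θ i))) (shift M) =
      shift (subst σ θ M) := by
  simp [shift, subst_rename, rename_subst]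

theorem subst_subst {n m k : ℕ} (σ : A → Tm B m) (θ : Fin n → Tm B m) (σ' : B → Tm C k)
    (θ' : Fin m → Tm C k) (M : Tm A n) :
    subst σ' θ' (subst σ θ M) =
      subst (fun a => subst σ' θ' (σ a)) (fun i => subst σ' θ' (θ i)) M := by
  induction M generalizing m k with
  | fvar a => simp [subst]
  | bvar i => simp [subst]
  | lam M ih =>
      simp only [subst, ih, subst_shift]
      congr 2
      funext i
      cases i using Fin.cases <;> simp [subst, subst_shift]
  | app M N ihM ihN => simp [subst, ihM, ihN]
  | choice M N ihM ihN => simp [subst, ihM, ihN]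

theorem subst_id {n : ℕ} (M : Tm A n) : subst fvar bvar M = M := by
  induction M with
  | fvar a => simp [subst]
  | bvar i => simp [subst]
  | @lam n M ih =>
      have h : (Fin.cases (bvar 0) (fun i => shift (bvar i)) : Fin (n + 1) → Tm A (n + 1)) =
          bvar := by
        funext i
        cases i using Fin.cases <;> simp [shift, rename]
      rw [subst, h]
      simpa [shift, rename] using ih
  | app M N ihM ihN => simp [subst, ihM, ihN]
  | choice M N ihM ihN => simp [subst, ihM, ihN]

/-- Substitution for the free variables of a term without dangling indices. -/
def fill (σ : A → Tm B 0) (M : Tm A 0) : Tm B 0 := subst σ Fin.elim0 M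

/-- Substitution for the free variables of the body of an abstraction. -/
def fillBody (σ : A → Tm B 0) (P : Tm A 1) : Tm B 1 :=
  subst (fun a => shift (σ a)) (Fin.cases (bvar 0) (fun i => shift (Fin.elim0 i))) P

theorem subst_shift_zero (τ : A → Tm B 0) (θ : Fin 1 → Tm B 0) (M : Tm A 0) :
    subst τ θ (shift M) = fill τ M := by
  rw [shift, subst_rename, fill]
  congr 1
  funext i
  exact i.elim0

theorem fill_fvar (M : Tm A 0) : fill fvar M = M := by
  have h : (Fin.elim0 : Fin 0 → Tm A 0) = bvar := funext fun i => i.elim0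
  rw [fill, h, subst_id]

theorem inst_fillBody (σ : A → Tm B 0) (P : Tm A 1) (N : Tm B 0) :
    inst (fillBody σ P) N = subst σ (fun _ => N) P := by
  rw [inst, fillBody, subst_subst]
  congr 1
  · funext a
    rw [subst_shift_zero, fill_fvar]
  · funext i
    cases i using Fin.cases with
    | zero => simp [subst]
    | succ i => exact i.elim0

/-- Contexts are stable under beta reduction: contracting before or after filling the holes gives
the same term. -/
theorem fill_inst (σ : A → Tm B 0) (P : Tm A 1) (N : Tm A 0) :
    fill σ (inst P N) = inst (fillBody σ P) (fill σ N) := by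
  rw [inst_fillBody, inst, fill, subst_subst]
  rfl

/-- Lets a closed body be regarded as a context without holes, which no filling changes. -/
theorem fillBody_fill_empty [IsEmpty A] (σ : B → Tm A 0) (P : Tm A 1) :
    fillBody σ (subst (isEmptyElim : A → Tm B 1) bvar P) = P := by
  rw [fillBody, subst_subst]
  conv_rhs => rw [← subst_id P]
  congr 1
  · funext a
    exact isEmptyElim a
  · funext i
    cases i using Fin.cases with
    | zero => simp [subst]
    | succ i => exact i.elim0

end Tm

/-! ## Similarity and bisimilarity on labelled Markov chains -/

namespace LMC

variable {S L I : Type} [Countable S] (C : LMC S L I)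

theorem probSet_mono (s : S) (l : L) {X Y : Set S} (h : X ⊆ Y) :
    C.probSet s l X ≤ C.probSet s l Y :=
  ENNReal.tsum_mono_subtype _ h

theorem probSet_le_one (s : S) (l : L) (X : Set S) : C.probSet s l X ≤ 1 :=
  (ENNReal.tsum_comp_le_tsum_of_injective Subtype.val_injective _).trans (C.prob_le_one s l)

variable {C}

/-- Along a chain of steps the inequalities compose, because the image of an image under the closure
stays in the image. It is therefore enough that a single step lands in the closure. -/
theorem isSimulation_reflTransGen {R : S → S → Prop}
    (hsort : ∀ s t, R s t → C.sort s = C.sort t)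
    (hprob : ∀ s t, R s t → ∀ (l : L) (X : Set S),
      C.probSet s l X ≤ C.probSet t l {y | ∃ x ∈ X, Relation.ReflTransGen R x y}) :
    C.IsSimulation (Relation.ReflTransGen R) where
  refl _ := .refl
  trans _ _ _ := .trans
  sort_eq s t h := by
    induction h with
    | refl => rfl
    | tail _ h ih => exact ih.trans (hsort _ _ h)
  prob_le s t h l X := by
    induction h with
    | refl => exact C.probSet_mono _ _ fun x hx => ⟨x, hx, .refl⟩
    | tail _ h ih =>
        refine (ih.trans (hprob _ _ h _ _)).trans (C.probSet_mono _ _ ?_)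
        rintro z ⟨y, ⟨x, hx, hxy⟩, hyz⟩
        exact ⟨x, hx, hxy.trans hyz⟩

/-- A union of preorders need not be transitive. Its reflexive transitive closure is however a
simulation, hence already contained in the union. -/
theorem similar_isSimulation : C.IsSimulation C.Similar := by
  have key : C.IsSimulation (Relation.ReflTransGen C.Similar) := by
    refine isSimulation_reflTransGen ?_ ?_
    · rintro s t ⟨R, hR, h⟩
      exact hR.sort_eq _ _ h
    · rintro s t ⟨R, hR, h⟩ l X
      refine (hR.prob_le _ _ h l X).trans (C.probSet_mono _ _ ?_)
      rintro y ⟨x, hx, hxy⟩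
      exact ⟨x, hx, .single ⟨R, hR, hxy⟩⟩
  have h : Relation.ReflTransGen C.Similar = C.Similar := by
    funext s t
    exact propext ⟨fun h => ⟨_, key, h⟩, .single⟩
  rwa [h] at key

theorem Similar.refl (s : S) : C.Similar s s := similar_isSimulation.refl s

theorem Similar.trans {s t u : S} (h : C.Similar s t) (h' : C.Similar t u) : C.Similar s u :=
  similar_isSimulation.trans _ _ _ h h'

/-- A relation that is a simulation except for being a preorder is contained in similarity. -/
theorem similar_of_step {R : S → S → Prop}
    (hsort : ∀ s t, R s t → C.sort s = C.sort t)
    (hprob : ∀ s t, R s t → ∀ (l : L) (X : Set S),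
      C.probSet s l X ≤ C.probSet t l {y | ∃ x ∈ X, R x y}) {s t : S} (h : R s t) :
    C.Similar s t := by
  refine ⟨_, isSimulation_reflTransGen hsort fun s t h l X => ?_, .single h⟩
  refine (hprob _ _ h l X).trans (C.probSet_mono _ _ ?_)
  rintro y ⟨x, hx, hxy⟩
  exact ⟨x, hx, .single hxy⟩

/-- The image of `X` contains `X` and is a disjoint union of equivalence classes, so its probability
is the sum over these classes, on each of which the two states agree. -/
theorem IsBisimulation.isSimulation {R : S → S → Prop} (hR : C.IsBisimulation R) :
    C.IsSimulation R where
  refl := hR.equivalence.refl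
  trans _ _ _ := hR.equivalence.trans
  sort_eq := hR.sort_eq
  prob_le s t h l X := by
    refine (C.probSet_mono s l (fun x hx => ⟨x, hx, hR.equivalence.refl x⟩ :
      X ⊆ {y | ∃ x ∈ X, R x y})).trans ?_
    let r : Setoid S := ⟨R, hR.equivalence⟩
    let Y : Set (Quotient r) := Quotient.mk r '' X
    have hY : {y | ∃ x ∈ X, R x y} = ⋃ c : Y, {y | Quotient.mk r y = c} := by
      ext y
      rw [Set.mem_iUnion]
      constructor
      · rintro ⟨x, hx, hxy⟩
        exact ⟨⟨_, x, hx, rfl⟩, (Quotient.sound hxy).symm⟩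
      · rintro ⟨⟨_, x, hx, rfl⟩, h⟩
        exact ⟨x, hx, Quotient.exact (Eq.symm h)⟩
    have hdisj : Pairwise (Function.onFun Disjoint fun c : Y => {y | Quotient.mk r y = c}) := by
      intro c d hcd
      refine Set.disjoint_left.2 fun y hc hd => hcd (Subtype.ext ?_)
      exact Eq.trans (Eq.symm hc) hd
    have hsum : ∀ u, C.probSet u l {y | ∃ x ∈ X, R x y} =
        ∑' c : Y, C.probSet u l {y | Quotient.mk r y = c} := by
      intro u
      rw [hY]
      exact ENNReal.tsum_biUnion (Set.pairwise_univ.2 hdisj)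
    refine (hsum s).trans_le (le_trans ?_ (hsum t).ge)
    refine ENNReal.tsum_le_tsum fun c => ?_
    obtain ⟨c, x, hx, rfl⟩ := c
    have hc : {y | Quotient.mk r y = Quotient.mk r x} = {v | R x v} := by
      ext y
      exact ⟨fun h => Quotient.exact h.symm, fun h => (Quotient.sound h).symm⟩
    exact le_of_eq (by simpa only [hc] using hR.prob_eq s t h l x)

/-- Similarity of both states is a bisimulation. -/
theorem isBisimulation_similar :
    C.IsBisimulation fun s t => C.Similar s t ∧ C.Similar t s where
  equivalence :=
    ⟨fun s => ⟨.refl s, .refl s⟩, fun h => ⟨h.2, h.1⟩,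
      fun h h' => ⟨h.1.trans h'.1, h'.2.trans h.2⟩⟩
  sort_eq s t h := similar_isSimulation.sort_eq _ _ h.1
  prob_eq s t h l u := by
    -- Mutually similar states agree on upward closed sets; a class is then recovered as a
    -- difference of two such sets, `E ∪ F` and `F`.
    have hup : ∀ {s t : S}, C.Similar s t → ∀ X : Set S,
        (∀ x ∈ X, ∀ y, C.Similar x y → y ∈ X) → C.probSet s l X ≤ C.probSet t l X := by
      intro s t h X hX
      refine (similar_isSimulation.prob_le _ _ h l X).trans (C.probSet_mono _ _ ?_)
      rintro y ⟨x, hx, hxy⟩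
      exact hX x hx y hxy
    have heq : ∀ X : Set S, (∀ x ∈ X, ∀ y, C.Similar x y → y ∈ X) →
        C.probSet s l X = C.probSet t l X :=
      fun X hX => le_antisymm (hup h.1 X hX) (hup h.2 X hX)
    set E : Set S := {v | C.Similar u v ∧ C.Similar v u}
    set F : Set S := {v | C.Similar u v ∧ ¬ C.Similar v u}
    have hEF : ∀ s, C.probSet s l (E ∪ F) = C.probSet s l E + C.probSet s l F := by
      intro s
      refine ENNReal.summable.tsum_union_disjoint ?_ ENNReal.summable
      exact Set.disjoint_left.2 fun v hE hF => hF.2 hE.2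
    have hF := heq F fun x hx y hxy => ⟨hx.1.trans hxy, fun h => hx.2 (hxy.trans h)⟩
    have hU := heq (E ∪ F) fun x hx y hxy => by
      have hux : C.Similar u x := hx.elim (·.1) (·.1)
      by_cases hyu : C.Similar y u
      · exact .inl ⟨hux.trans hxy, hyu⟩
      · exact .inr ⟨hux.trans hxy, hyu⟩
    rw [hEF, hEF, hF] at hU
    -- Cancelling `F` is legitimate because its probability is finite.
    exact (ENNReal.add_left_inj ((C.probSet_le_one t l F).trans_lt ENNReal.one_lt_top).ne).1 hU

theorem bisimilar_iff {s t : S} : C.Bisimilar s t ↔ C.Similar s t ∧ C.Similar t s :=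
  ⟨fun ⟨_, hR, h⟩ =>
    ⟨⟨_, hR.isSimulation, h⟩, ⟨_, hR.isSimulation, hR.equivalence.symm h⟩⟩,
   fun h => ⟨_, isBisimulation_similar, h⟩⟩

end LMC

theorem pab_iff {M N : Closed} : PAB M N ↔ PAS M N ∧ PAS N M := LMC.bisimilar_iff

/-! ## Integration against discrete measures -/

/-- The mass that a discrete measure gives to a set. -/
def mass {α : Type} (p : α → ℝ≥0∞) (X : Set α) : ℝ≥0∞ := ∑' a, X.indicator p a

theorem mass_mono {α : Type} {p q : α → ℝ≥0∞} {X Y : Set α} (h : p ≤ q) (h' : X ⊆ Y) :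
    mass p X ≤ mass q Y :=
  ENNReal.tsum_le_tsum fun a =>
    (Set.indicator_le_indicator (h a)).trans
      (Set.indicator_le_indicator_of_subset h' (fun _ => zero_le) a)

theorem le_mass {α : Type} (p : α → ℝ≥0∞) {X : Set α} {a : α} (h : a ∈ X) : p a ≤ mass p X :=
  (Set.indicator_of_mem h p).ge.trans (ENNReal.le_tsum a)

open MeasureTheory in
theorem lintegral_indicator_ofReal_lt (c : ℝ≥0∞) :
    ∫⁻ t in Set.Ioi (0 : ℝ), {t : ℝ | ENNReal.ofReal t < c}.indicator 1 t = c := by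
  have hm : MeasurableSet {t : ℝ | ENNReal.ofReal t < c} :=
    measurableSet_lt ENNReal.measurable_ofReal measurable_const
  rw [lintegral_indicator_one hm, Measure.restrict_apply hm]
  induction c with
  | top => simp
  | coe c =>
      have h : {t : ℝ | ENNReal.ofReal t < c} ∩ Set.Ioi 0 = Set.Ioo 0 (c : ℝ) := by
        ext t
        refine and_comm.trans (and_congr_right fun ht : 0 < t => ?_)
        change ENNReal.ofReal t < c ↔ t < c
        rw [← ENNReal.ofReal_coe_nnreal, ENNReal.ofReal_lt_ofReal_iff_of_nonneg ht.le]
      rw [h, Real.volume_Ioo, sub_zero, ENNReal.ofReal_coe_nnreal]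

open MeasureTheory in
/-- The layer cake formula for discrete measures. -/
theorem tsum_mul_eq_lintegral_mass {α : Type} [Countable α] (p f : α → ℝ≥0∞) :
    ∑' a, p a * f a =
      ∫⁻ t in Set.Ioi (0 : ℝ), mass p {a | ENNReal.ofReal t < f a} := by
  have hm : ∀ a, MeasurableSet {t : ℝ | ENNReal.ofReal t < f a} := fun a =>
    measurableSet_lt ENNReal.measurable_ofReal measurable_const
  have h : ∀ (t : ℝ) (a : α), {a | ENNReal.ofReal t < f a}.indicator p a =
      p a * {t : ℝ | ENNReal.ofReal t < f a}.indicator 1 t := by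
    intro t a
    by_cases h : ENNReal.ofReal t < f a <;> simp [h]
  simp only [mass, h]
  rw [lintegral_tsum fun a =>
    ((measurable_one.indicator (hm a)).const_mul _).aemeasurable]
  refine tsum_congr fun a => ?_
  rw [lintegral_const_mul _ (measurable_one.indicator (hm a)), lintegral_indicator_ofReal_lt]

/-- By the layer cake formula only superlevel sets matter: the `R`-image of the part of `{f > t}`
charged by `p` lies in `{g > t}`. -/
theorem tsum_mul_le_of_mass_le {α : Type} [Countable α] {p q f g : α → ℝ≥0∞} {R : α → α → Prop}
    (hR : ∀ X, mass p X ≤ mass q {b | ∃ a ∈ X, R a b})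
    (hfg : ∀ a b, p a ≠ 0 → R a b → f a ≤ g b) : ∑' a, p a * f a ≤ ∑' b, q b * g b := by
  rw [tsum_mul_eq_lintegral_mass, tsum_mul_eq_lintegral_mass]
  refine MeasureTheory.lintegral_mono fun t => ?_
  -- Points of zero mass are discarded first, since `hfg` says nothing about them.
  have h : mass p {a | ENNReal.ofReal t < f a} =
      mass p {a | p a ≠ 0 ∧ ENNReal.ofReal t < f a} := by
    refine tsum_congr fun a => ?_
    by_cases ha : p a = 0 <;> simp [Set.indicator, ha]
  rw [h]
  refine (hR _).trans (mass_mono le_rfl ?_)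
  rintro b ⟨a, ⟨hp, ha⟩, hab⟩
  exact ha.trans_le (hfg a b hp hab)

/-! ## Semantics -/

/-- A finitely supported value distribution as a discrete measure. -/
def weight (D : Value →₀ ℝ≥0) (V : Value) : ℝ≥0∞ := (D V : ℝ≥0)

theorem BigStep.weight_le {M : Closed} {D : Value →₀ ℝ≥0} (h : BigStep M D) :
    weight D ≤ sem M := fun V =>
  le_iSup (fun D : {D : Value →₀ ℝ≥0 // BigStep M D} => ((D.1 V : ℝ≥0) : ℝ≥0∞)) ⟨D, h⟩

/-- Directedness of the approximations lets the supremum be exchanged with finite sums. -/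
theorem mass_sem_le {M : Closed} {X : Set Value} {c : ℝ≥0∞}
    (h : ∀ D, BigStep M D → mass (weight D) X ≤ c) : mass (sem M) X ≤ c := by
  rw [mass, ← tsum_subtype, ENNReal.tsum_eq_iSup_sum]
  refine iSup_le fun s => ?_
  unfold sem
  rw [ENNReal.finsetSum_iSup]
  · refine iSup_le fun D => le_trans ?_ (h D.1 D.2)
    rw [mass, ← tsum_subtype]
    exact ENNReal.sum_le_tsum s
  · intro D D'
    obtain ⟨F, hF, h1, h2⟩ := D.2.directed D'.2
    exact ⟨⟨F, hF⟩, fun V => ⟨by exact_mod_cast h1 V, by exact_mod_cast h2 V⟩⟩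

theorem one_le_sem_lam (P : Tm {x : Var // x ∈ (∅ : Finset Var)} 1) :
    1 ≤ sem (Tm.lam P) (Value.mk P) := by
  simpa [weight] using (BigStep.bv P).weight_le (Value.mk P)

instance (M : Closed) : Nonempty {D : Value →₀ ℝ≥0 // BigStep M D} := ⟨⟨0, .bt M⟩⟩

theorem le_sem_choice (M N : Closed) (V : Value) :
    1 / 2 * sem M V + 1 / 2 * sem N V ≤ sem (Tm.choice M N) V := by
  unfold sem
  simp only [ENNReal.mul_iSup]
  refine ENNReal.iSup_add_iSup_le fun D E => ?_
  refine le_trans (le_of_eq ?_) ((BigStep.bs D.2 E.2).weight_le V)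
  simp [weight]

theorem le_sem_app (M N : Closed) (V : Value) :
    ∑' W, sem M W * sem (W.body.inst N) V ≤ sem (Tm.app M N) V := by
  classical
  rw [ENNReal.tsum_eq_iSup_sum]
  refine iSup_le fun s => ?_
  -- An index picks an approximation of `M` together with one for every continuation, so that a
  -- single index serves all `W` in the finite sum.
  have hM : ∀ W, sem M W * sem (W.body.inst N) V =
      ⨆ i : {D : Value →₀ ℝ≥0 // BigStep M D} ×
        (∀ W : Value, {E : Value →₀ ℝ≥0 // BigStep (W.body.inst N) E}),
        (i.1.1 W : ℝ≥0∞) * ((i.2 W).1 V : ℝ≥0∞) := by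
    intro W
    rw [iSup_prod]
    simp only [sem, ENNReal.iSup_mul, ← ENNReal.mul_iSup]
    refine iSup_congr fun D => congrArg _ ?_
    exact (Function.surjective_eval (β := fun W : Value =>
      {E : Value →₀ ℝ≥0 // BigStep (W.body.inst N) E}) W).iSup_comp
        (fun E => ((E.1 V : ℝ≥0) : ℝ≥0∞)) |>.symm
  simp only [hM]
  rw [ENNReal.finsetSum_iSup]
  · refine iSup_le fun ⟨D, E⟩ => ?_
    refine le_trans ?_ ((BigStep.ba (fun W => (E W).1) D.2 fun W _ => (E W).2).weight_le V)
    -- The support of `D` and the finite set `s` are unrelated, so both sums are compared on their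
    -- union.
    rw [sum_superset (s := D.1.support ∪ s) Finset.subset_union_left]
    simp only [weight, Finsupp.finsetSum_apply, Finsupp.smul_apply, smul_eq_mul,
      ENNReal.ofNNReal_finsetSum, ENNReal.coe_mul]
    exact Finset.sum_le_sum_of_subset Finset.subset_union_right
  · rintro ⟨D, E⟩ ⟨D', E'⟩
    obtain ⟨F, hF, h1, h2⟩ := D.2.directed D'.2
    choose G hG h3 h4 using fun W => (E W).2.directed (E' W).2
    exact ⟨⟨⟨F, hF⟩, fun W => ⟨G W, hG W⟩⟩, fun W =>
      ⟨mul_le_mul' (by exact_mod_cast h1 W) (by exact_mod_cast h3 W V),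
        mul_le_mul' (by exact_mod_cast h2 W) (by exact_mod_cast h4 W V)⟩⟩

theorem mass_weight_single {P : Tm {x : Var // x ∈ (∅ : Finset Var)} 1} {X Y : Set Value}
    {p : Value → ℝ≥0∞} {V : Value} (hV : 1 ≤ p V) (h : Value.mk P ∈ X → V ∈ Y) :
    mass (weight (Finsupp.single (Value.mk P) 1)) X ≤ mass p Y := by
  classical
  rw [mass, tsum_eq_single (Value.mk P)]
  · by_cases hX : Value.mk P ∈ X
    · simpa [hX, weight] using hV.trans (le_mass p (h hX))
    · simp [hX]
  · intro W hW
    simp [weight, Set.indicator, Ne.symm hW]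

/-! ## Transitions -/

theorem probSet_eval (M : Closed) (X : Set State) :
    chain.probSet (.inl M) (.inr ()) X = mass (sem M) (Sum.inr ⁻¹' X) := by
  rw [LMC.probSet, tsum_subtype, Summable.tsum_sum ENNReal.summable ENNReal.summable]
  have h : ∀ N : Closed, X.indicator (chain.prob (.inl M) (.inr ())) (.inl N) = 0 := by
    intro N
    simp [chain, transProb, Set.indicator]
  simp only [h, tsum_zero, zero_add]
  rfl

open Classical in
theorem probSet_apply (V : Value) (N : Closed) (X : Set State) :
    chain.probSet (.inr V) (.inl N) X = if .inl (V.body.inst N) ∈ X then 1 else 0 := by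
  rw [LMC.probSet, tsum_subtype, tsum_eq_single (.inl (V.body.inst N))]
  · simp [Set.indicator, chain, transProb]
  · rintro (M | W) h
    · have h' : M ≠ V.body.inst N := fun h' => h (by rw [h'])
      simp [Set.indicator, chain, transProb, h']
    · simp [Set.indicator, chain, transProb]

theorem probSet_term_term (M N : Closed) (X : Set State) :
    chain.probSet (.inl M) (.inl N) X = 0 := by
  simp [LMC.probSet, chain, transProb]

theorem probSet_value_eval (V : Value) (X : Set State) :
    chain.probSet (.inr V) (.inr ()) X = 0 := by
  simp [LMC.probSet, chain, transProb]

/-- Combines a relation on terms and one on values into one on states. -/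
def stateRel (R : Closed → Closed → Prop) (Q : Value → Value → Prop) : State → State → Prop
  | .inl M, .inl N => R M N
  | .inr V, .inr W => Q V W
  | _, _ => False

/-- The coinduction principle for this chain: all other combinations of state and label have
probability zero. -/
theorem pas_of_step {R : Closed → Closed → Prop} {Q : Value → Value → Prop}
    (hR : ∀ M N, R M N → ∀ X, mass (sem M) X ≤ mass (sem N) {W | ∃ V ∈ X, Q V W})
    (hQ : ∀ V W, Q V W → ∀ N, R (V.body.inst N) (W.body.inst N)) {M N : Closed} (h : R M N) :
    PAS M N := by
  refine LMC.similar_of_step (R := stateRel R Q) ?_ ?_ (s := .inl M) (t := .inl N) h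
  · rintro (M | V) (N | W) h <;> first | exact h.elim | rfl
  · rintro (M | V) (N | W) h l X
    · rcases l with L | _
      · rw [probSet_term_term]
        exact zero_le
      · rw [probSet_eval, probSet_eval]
        refine (hR M N h _).trans (mass_mono le_rfl ?_)
        rintro W ⟨V, hV, hVW⟩
        exact ⟨_, hV, hVW⟩
    · exact h.elim
    · exact h.elim
    · rcases l with L | _
      · rw [probSet_apply, probSet_apply]
        by_cases hX : .inl (V.body.inst L) ∈ X
        · have hX' : (.inl (W.body.inst L) : State) ∈ {y | ∃ x ∈ X, stateRel R Q x y} :=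
            ⟨_, hX, hQ V W h L⟩
          simp only [hX, hX', if_true, le_refl]
        · simp [hX]
      · rw [probSet_value_eval]
        exact zero_le

theorem PAS.refl (M : Closed) : PAS M M := LMC.Similar.refl _

theorem PAS.trans {M N L : Closed} (h : PAS M N) (h' : PAS N L) : PAS M L :=
  LMC.Similar.trans h h'

/-- Pointwise similarity of abstractions. -/
def ValueLe (V W : Value) : Prop := ∀ N : Closed, PAS (V.body.inst N) (W.body.inst N)

theorem PAS.mass_le {M N : Closed} (h : PAS M N) (X : Set Value) :
    mass (sem M) X ≤ mass (sem N) {W | ∃ V ∈ X, ValueLe V W} := by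
  have h' := LMC.similar_isSimulation.prob_le _ _ h (.inr ()) (Sum.inr '' X)
  rw [probSet_eval, probSet_eval, Set.preimage_image_eq _ Sum.inr_injective] at h'
  refine h'.trans (mass_mono le_rfl ?_)
  rintro W ⟨_, ⟨V, hV, rfl⟩, hVW⟩
  refine ⟨V, hV, fun N => ?_⟩
  -- Application is deterministic: testing on the single successor of `V` would give `1 ≤ 0` if the
  -- successors were not similar.
  have h2 := LMC.similar_isSimulation.prob_le _ _ hVW (.inl N) {.inl (V.body.inst N)}
  rw [probSet_apply, probSet_apply] at h2
  by_contra hn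
  have hn' : (.inl (W.body.inst N) : State) ∉
      {y | ∃ x ∈ ({.inl (V.body.inst N)} : Set State), chain.Similar x y} := by
    rintro ⟨_, rfl, h⟩
    exact hn h
  rw [if_neg hn', if_pos (Set.mem_singleton _)] at h2
  exact absurd h2 (by simp)

theorem pas_lam {P Q : Tm {x : Var // x ∈ (∅ : Finset Var)} 1}
    (h : ∀ N, PAS (P.inst N) (Q.inst N)) : PAS (Tm.lam P) (Tm.lam Q) := by
  -- Adjoining just this pair to similarity suffices, as applying the two values leads back into
  -- similarity.
  refine pas_of_step (R := fun M N => PAS M N ∨ M = Tm.lam P ∧ N = Tm.lam Q) (Q := ValueLe)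
    ?_ (fun V W h N => .inl (h N)) (.inr ⟨rfl, rfl⟩)
  rintro M N (h' | ⟨rfl, rfl⟩) X
  · exact h'.mass_le X
  · refine mass_sem_le fun D hD => ?_
    cases hD with
    | bt => simp [mass, weight, Set.indicator]
    | bv => exact mass_weight_single (one_le_sem_lam Q) fun hX => ⟨_, hX, h⟩

/-! ## Contexts with similar terms in their holes -/

/-- Pairs of similar terms, used as names of the holes of a context. -/
abbrev Hole : Type := {p : Closed × Closed // PAS p.1 p.2}

/-- Fill the holes of a context with the smaller terms. -/
def lower (C : Tm Hole 0) : Closed := Tm.fill (fun a => a.1.1) C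

/-- Fill the holes of a context with the larger terms. -/
def upper (C : Tm Hole 0) : Closed := Tm.fill (fun a => a.1.2) C

/-- The closure under contexts of similarity, composed with similarity. -/
def CtxLe (M N : Closed) : Prop := ∃ C : Tm Hole 0, lower C = M ∧ PAS (upper C) N

/-- The version of `CtxLe` for values. -/
def CtxValueLe (V W : Value) : Prop :=
  ∃ P : Tm Hole 1, Tm.fillBody (fun a => a.1.1) P = V.body ∧
    ∀ N, PAS ((Tm.fillBody (fun a => a.1.2) P).inst N) (W.body.inst N)

theorem ValueLe.ctxValueLe {V W : Value} (h : ValueLe V W) : CtxValueLe V W := by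
  refine ⟨Tm.subst isEmptyElim Tm.bvar V.body, Tm.fillBody_fill_empty _ _, fun N => ?_⟩
  rw [Tm.fillBody_fill_empty]
  exact h N

theorem CtxValueLe.trans_valueLe {V W U : Value} (h : CtxValueLe V W) (h' : ValueLe W U) :
    CtxValueLe V U := by
  obtain ⟨P, hP, hW⟩ := h
  exact ⟨P, hP, fun N => (hW N).trans (h' N)⟩

/-- The argument `N` is plugged in as a hole named by the reflexive pair `(N, N)`. -/
theorem CtxValueLe.ctxLe_inst {V W : Value} (h : CtxValueLe V W) (N : Closed) :
    CtxLe (V.body.inst N) (W.body.inst N) := by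
  obtain ⟨P, hP, hW⟩ := h
  refine ⟨P.inst (.fvar ⟨(N, N), .refl N⟩), ?_, ?_⟩
  · rw [lower, Tm.fill_inst, hP]
    rfl
  · rw [upper, Tm.fill_inst]
    exact hW N

/-- The set of values measured is closed under `ValueLe`; this is what the trailing similarity in
`CtxValueLe` is for. -/
theorem PAS.mass_ctx_le {M N : Closed} (h : PAS M N) (X : Set Value) :
    mass (sem M) {W | ∃ V ∈ X, CtxValueLe V W} ≤
      mass (sem N) {W | ∃ V ∈ X, CtxValueLe V W} := by
  refine (h.mass_le _).trans (mass_mono le_rfl ?_)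
  rintro U ⟨W, ⟨V, hV, hVW⟩, hWU⟩
  exact ⟨V, hV, hVW.trans_valueLe hWU⟩

/-- The case of a context that is a single hole: whatever rule derived `D`, similarity of the pair
already suffices. -/
theorem mass_weight_fvar_le {M N : Closed} (h : PAS M N) {D : Value →₀ ℝ≥0} (hD : BigStep M D)
    (X : Set Value) : mass (weight D) X ≤ mass (sem N) {W | ∃ V ∈ X, CtxValueLe V W} := by
  refine ((mass_mono hD.weight_le le_rfl).trans (h.mass_le X)).trans (mass_mono le_rfl ?_)
  rintro W ⟨V, hV, hVW⟩
  exact ⟨V, hV, hVW.ctxValueLe⟩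

theorem mass_sum_smul (D : Value →₀ ℝ≥0) (E : Value → (Value →₀ ℝ≥0)) (X : Set Value) :
    mass (weight (∑ V ∈ D.support, D V • E V)) X = ∑' V, weight D V * mass (weight (E V)) X := by
  rw [tsum_eq_sum (s := D.support) fun V hV => by
    simp [weight, Finsupp.notMem_support_iff.1 hV]]
  simp only [mass, ← ENNReal.tsum_mul_left]
  rw [← Summable.tsum_finsetSum fun _ _ => ENNReal.summable]
  refine tsum_congr fun W => ?_
  by_cases hW : W ∈ X <;>
    simp [hW, weight, Finsupp.finsetSum_apply, ENNReal.ofNNReal_finsetSum]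

theorem le_mass_sem_app (M N : Closed) (X : Set Value) :
    ∑' W, sem M W * mass (sem (W.body.inst N)) X ≤ mass (sem (Tm.app M N)) X := by
  simp only [mass, ← ENNReal.tsum_mul_left]
  rw [ENNReal.tsum_comm]
  refine ENNReal.tsum_le_tsum fun V => ?_
  by_cases hV : V ∈ X
  · simpa [hV] using le_sem_app M N V
  · simp [hV]

theorem mass_half_add (p q : Value → ℝ≥0∞) (X : Set Value) :
    mass (fun V => 1 / 2 * p V + 1 / 2 * q V) X = 1 / 2 * mass p X + 1 / 2 * mass q X := by
  simp only [mass, ← ENNReal.tsum_mul_left, ← ENNReal.tsum_add]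
  refine tsum_congr fun V => ?_
  by_cases hV : V ∈ X <;> simp [hV]

/-- The key lemma: replacing the terms in the holes by larger ones yields a larger semantics. -/
theorem BigStep.mass_le_upper {M : Closed} {D : Value →₀ ℝ≥0} (h : BigStep M D) :
    ∀ (C : Tm Hole 0), lower C = M → ∀ X : Set Value,
      mass (weight D) X ≤ mass (sem (upper C)) {W | ∃ V ∈ X, CtxValueLe V W} := by
  -- The context stays universally quantified: contracting a redex may produce a larger context, so
  -- only the derivation decreases.
  induction h with
  | bt M =>
      intro C _ X
      simp [mass, weight, Set.indicator]
  | bv P =>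
      intro C hC X
      cases C with
      | fvar a => exact mass_weight_fvar_le (hC ▸ a.2) (.bv P) X
      | bvar i => exact i.elim0
      | lam Q =>
          refine mass_weight_single (V := Value.mk (Tm.fillBody (fun a : Hole => a.1.2) Q))
            (one_le_sem_lam (Tm.fillBody (fun a : Hole => a.1.2) Q)) fun hX =>
              ⟨_, hX, Q, ?_, fun N => .refl _⟩
          exact Tm.lam.inj hC
      | app => cases hC
      | choice => cases hC
  | @ba M N D E hM hE ihM ihE =>
      intro C hC X
      cases C with
      | fvar a => exact mass_weight_fvar_le (hC ▸ a.2) (.ba E hM hE) X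
      | bvar i => exact i.elim0
      | lam => cases hC
      | app C₁ C₂ =>
          obtain ⟨hC₁, hC₂⟩ : lower C₁ = M ∧ lower C₂ = N := Tm.app.inj hC
          rw [mass_sum_smul]
          refine le_trans ?_ (le_mass_sem_app (upper C₁) (upper C₂) _)
          refine tsum_mul_le_of_mass_le (R := CtxValueLe) (ihM C₁ hC₁) ?_
          rintro V W hV ⟨P, hP, hW⟩
          have hV' : V ∈ D.support := Finsupp.mem_support_iff.2 fun h => hV (by simp [weight, h])
          -- The continuation is the context `P.inst C₂`: its lower filling is the term evaluated in
          -- the derivation, and its upper filling is similar to the continuation of `W` with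
          -- argument `upper C₂`.
          refine (ihE V hV' (P.inst C₂) ?_ X).trans (PAS.mass_ctx_le ?_ X)
          · rw [lower, Tm.fill_inst, hP, ← hC₂]
            rfl
          · rw [upper, Tm.fill_inst]
            exact hW (upper C₂)
      | choice => cases hC
  | @bs M N D E hM hN ihM ihN =>
      intro C hC X
      cases C with
      | fvar a => exact mass_weight_fvar_le (hC ▸ a.2) (.bs hM hN) X
      | bvar i => exact i.elim0
      | lam => cases hC
      | app => cases hC
      | choice C₁ C₂ =>
          obtain ⟨hC₁, hC₂⟩ : lower C₁ = M ∧ lower C₂ = N := Tm.choice.inj hC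
          have hw : weight ((1 / 2 : ℝ≥0) • D + (1 / 2 : ℝ≥0) • E) =
              fun V => 1 / 2 * weight D V + 1 / 2 * weight E V := by
            funext V
            simp [weight]
          rw [hw, mass_half_add]
          refine (add_le_add (mul_le_mul_right (ihM C₁ hC₁ X) _)
            (mul_le_mul_right (ihN C₂ hC₂ X) _)).trans ?_
          rw [← mass_half_add]
          exact mass_mono (le_sem_choice (upper C₁) (upper C₂)) le_rfl

theorem CtxLe.pas {M N : Closed} (h : CtxLe M N) : PAS M N := by
  refine pas_of_step (R := CtxLe) (Q := CtxValueLe) ?_ (fun _ _ h => h.ctxLe_inst) h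
  rintro M N ⟨C, hC, hN⟩ X
  exact (mass_sem_le fun D hD => hD.mass_le_upper C hC X).trans (hN.mass_ctx_le X)

theorem PAS.app {M N L P : Closed} (h : PAS M N) (h' : PAS L P) :
    PAS (Tm.app M L) (Tm.app N P) :=
  CtxLe.pas ⟨.app (.fvar ⟨(M, N), h⟩) (.fvar ⟨(L, P), h'⟩), rfl, .refl _⟩

theorem PAS.choice {M N L P : Closed} (h : PAS M N) (h' : PAS L P) :
    PAS (Tm.choice M L) (Tm.choice N P) :=
  CtxLe.pas ⟨.choice (.fvar ⟨(M, N), h⟩) (.fvar ⟨(L, P), h'⟩), rfl, .refl _⟩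

/-! ## Open terms -/

/-- Extend a closing substitution by `x ↦ N`. -/
def extend {xs : Finset Var} (x : Var) (σ : {x : Var // x ∈ xs} → Closed) (N : Closed) :
    {y : Var // y ∈ insert x xs} → Closed :=
  fun y => if h : y.1 = x then N else σ ⟨y.1, Finset.mem_of_mem_insert_of_ne y.2 h⟩

/-- Applying a closed-off abstraction amounts to extending the closing substitution, so the open
hypothesis on the bodies covers every argument. -/
theorem exists_close_abs {xs : Finset Var} (x : Var) (σ : {x : Var // x ∈ xs} → Closed)
    (M : Term (insert x xs)) :
    ∃ P, close σ (abs x M) = Tm.lam P ∧ ∀ N, P.inst N = close (extend x σ N) M := by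
  refine ⟨_, rfl, fun N => ?_⟩
  refine (Tm.inst_fillBody σ _ N).trans ?_
  rw [Tm.subst_subst, close]
  congr 1
  · funext y
    unfold extend
    split_ifs <;> rfl
  · funext i
    exact i.elim0

theorem openExt_pas_abs {xs : Finset Var} {x : Var} {M N : Term (insert x xs)}
    (h : openExt PAS (insert x xs) M N) : openExt PAS xs (abs x M) (abs x N) := by
  intro σ
  obtain ⟨P, hP, hP'⟩ := exists_close_abs x σ M
  obtain ⟨Q, hQ, hQ'⟩ := exists_close_abs x σ N
  rw [hP, hQ]
  refine pas_lam fun L => ?_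
  rw [hP', hQ']
  exact h _

theorem openExt_pas_precongruence : (openExt PAS).Precongruence where
  compatible :=
    { com1 := fun _ _ _ _ => .refl _
      com2 := fun _ _ _ _ _ h => openExt_pas_abs h
      com3 := fun _ _ _ _ _ h h' σ => (h σ).app (h' σ)
      com4 := fun _ _ _ _ _ h h' σ => (h σ).choice (h' σ) }
  refl _ _ _ := .refl _
  trans _ _ _ _ h h' σ := (h σ).trans (h' σ)

theorem openExt_pab_iff {xs : Finset Var} {M N : Term xs} :
    openExt PAB xs M N ↔ openExt PAS xs M N ∧ openExt PAS xs N M := by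
  simp only [openExt, pab_iff, forall_and]

theorem openExt_pab_congruence : (openExt PAB).Congruence where
  compatible :=
    { com1 := fun _ _ _ => openExt_pab_iff.2 ⟨fun _ => .refl _, fun _ => .refl _⟩
      com2 := fun _ _ _ _ _ h =>
        have h := openExt_pab_iff.1 h
        openExt_pab_iff.2 ⟨openExt_pas_abs h.1, openExt_pas_abs h.2⟩
      com3 := fun _ _ _ _ _ h h' =>
        have h := openExt_pab_iff.1 h
        have h' := openExt_pab_iff.1 h'
        openExt_pab_iff.2 ⟨fun σ => (h.1 σ).app (h'.1 σ), fun σ => (h.2 σ).app (h'.2 σ)⟩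
      com4 := fun _ _ _ _ _ h h' =>
        have h := openExt_pab_iff.1 h
        have h' := openExt_pab_iff.1 h'
        openExt_pab_iff.2 ⟨fun σ => (h.1 σ).choice (h'.1 σ), fun σ => (h.2 σ).choice (h'.2 σ)⟩ }
  equivalence _ :=
    { refl := fun _ => openExt_pab_iff.2 ⟨fun _ => .refl _, fun _ => .refl _⟩
      symm := fun h => openExt_pab_iff.2 (openExt_pab_iff.1 h).symm
      trans := fun h h' =>
        have h := openExt_pab_iff.1 h
        have h' := openExt_pab_iff.1 h'
        openExt_pab_iff.2 ⟨fun σ => (h.1 σ).trans (h'.1 σ), fun σ => (h'.2 σ).trans (h.2 σ)⟩ }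

end ProbLambda

end

theorem mainTheorem1 :
    (ProbLambda.openExt ProbLambda.PAS).Precongruence ∧
      (ProbLambda.openExt ProbLambda.PAB).Congruence :=
  ⟨ProbLambda.openExt_pas_precongruence, ProbLambda.openExt_pab_congruence⟩
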